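/- **Setting.** Let $\mathcal P=\{p_1,\dots,p_n\}$ be a finite set of processes, $\mathbb F=[\mathcal F_1,\dots,\mathcal F_n]$ with $\mathcal F_i\subseteq 2^{\mathcal P}$ an asymmetric fail-prone system, and $\mathcal F_i^*=\{X : X\subseteq Y \text{ for some } Y\in\mathcal F_i\}$. Let $\mathbb Q=[\mathcal Q_1,\dots,\mathcal Q_n]$ with $\mathcal Q_i\subseteq 2^{\mathcal P}$ be an asymmetric Byzantine quorum system for $\mathbb F$, that is: * (consistency) $Q_i\cap Q_j\not\subseteq X$ for all $i,j$, $Q_i\in\mathcal Q_i$, $Q_j\in\mathcal Q_j$, $X\in\mathcal F_i^*\cap\mathcal F_j^*$; * (availability) for all $i$ and $F_i\in\mathcal F_i$ some $Q_i\in\mathcal Q_i$ is disjoint from $F_i$. A kernel for $p_i$ is a set of processes that meets every $Q_i\in\mathcal Q_i$. Let $F\subseteq\mathcal P$ be the set of faulty (Byzantine) processes of an execution. A process $p_i$ is correct if $p_i\notin F$, and wise if it is correct and $F\in\mathcal F_i^*$. A guild is a set of wise processes that contains a quorum of each of its members; the maximal guild $\mathcal G_{\max}$ is the union of all guilds. The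 execution is one *with a guild* if $\mathcal G_{\max}\ne\emptyset$. Processes communicate asynchronously over authenticated point-to-point links that are reliable between correct processes. They also use an asymmetric reliable broadcast (*arb*), which satisfies, in executions with a guild: * what a correct process arb-broadcasts is eventually arb-delivered by all of $\mathcal G_{\max}$; * any two values arb-delivered from the same sender by wise processes are equal; * no correct process arb-delivers the same message from a sender twice, and what a wise process arb-delivers from a correct sender was arb-broadcast before by that sender; * if a wise process arb-delivers something from a sender, then all of $\mathcal G_{\max}$ eventually arb-deliver something from that sender. **Protocol.** Each correct $p_i$ starts with $S_i=T_i=U_i=\emptyset$ and $\mathit{sentT}=\text{false}$, and runs the following rules. A rule triggered by a condition on the local state is executed once, after the condition has become true; a received message whose side condition fails stays pending. 1. On ag-propose$(x_i)$: arb-broadcast $(p_i,x_i)$. A process ag-proposes at most one value. 2. On arb-delivering $(p_j,x)$ from $p_j$: add $(p_j,x)$ to $S_i$. 3. When $S_i$ contains pairs from all members of some $Q_i\in\mathcal Q_i$: send $[\mathrm{DistributeS},S_i]$ to all. 4. On receiving $[\mathrm{DistributeS},S]$ from $p_j$ with $S\subseteq S_i$ and $\neg\mathit{sentT}$: set $T_i\leftarrow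 T_i\cup S$ and send $[\mathrm{Ack}]$ to $p_j$. 5. When $[\mathrm{Ack}]$ has been received from all members of some $Q_i\in\mathcal Q_i$: send $[\mathrm{Ready}]$ to all. 6. When $[\mathrm{Ready}]$ has been received from all members of some $Q_i\in\mathcal Q_i$, or $[\mathrm{Confirm}]$ from all members of some kernel for $p_i$: send $[\mathrm{Confirm}]$ to all. 7. When $[\mathrm{Confirm}]$ has been received from all members of some $Q_i\in\mathcal Q_i$: send $[\mathrm{DistributeT},T_i]$ to all and set $\mathit{sentT}\leftarrow\text{true}$. 8. On receiving $[\mathrm{DistributeT},T]$ from $p_j$ with $T\subseteq S_i$: accept it, setting $U_i\leftarrow U_i\cup T$. 9. When a $\mathrm{DistributeT}$ message has been accepted from each member of some $Q_i\in\mathcal Q_i$: ag-deliver $U_i$. **Lemma.** The protocol implements an asymmetric gather. That is, in every execution with a guild: * **Common core.** Suppose that every process of $\mathcal G_{\max}$ ag-proposes a value, or that at least one process of $\mathcal G_{\max}$ ag-delivers. Then there are $p_i\in\mathcal G_{\max}$, $Q_i\in\mathcal Q_i$ and a set $S^+=\{(p_j,x_j) : p_j\in Q_i\}$ such that each correct $p_j\in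 Q_i$ ag-proposed $x_j$, and $S^+\subseteq U$ for every set $U$ that is ag-delivered by a process of $\mathcal G_{\max}$. Moreover, there is $p_i\in\mathcal G_{\max}$ that sends a message $[\mathrm{DistributeS},C]$ whose set $C$ contains such an $S^+$ (with $x_j$ ag-proposed by $p_j$ for each correct $p_j$ in some $Q_i\in\mathcal Q_i$) and satisfies $C\subseteq U$ for every set $U$ that is ag-delivered by a process of $\mathcal G_{\max}$. * **Validity.** If a process of $\mathcal G_{\max}$ ag-delivers a set that contains $(p_j,x)$ and $p_j$ is wise, then $p_j$ ag-proposed $x$. * **Agreement.** If $U$ and $U'$ are ag-delivered by processes of $\mathcal G_{\max}$, $(p_j,x)\in U$ and $(p_j,x')\in U'$, then $x=x'$. * **Termination.** If every process of $\mathcal G_{\max}$ ag-proposes a value, then every process of $\mathcal G_{\max}$ ag-delivers a set. -/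

import Mathlib

namespace AsymGather

/-! ### Asymmetric trust -/

section Trust

variable {P : Type*}

/-- The collection of all subsets of members of `A`. -/
def subsetClosure (A : Set (Set P)) : Set (Set P) :=
  {X | ∃ Y ∈ A, X ⊆ Y}

/-- `Q` is an asymmetric Byzantine quorum system for the asymmetric fail-prone system `F`;
`F i` and `Q i` are the fail-prone sets and the quorums of the party `i`. -/
structure IsQuorumSystem (F Q : P → Set (Set P)) : Prop where
  consistency : ∀ i j, ∀ Qi ∈ Q i, ∀ Qj ∈ Q j,
    ∀ X ∈ subsetClosure (F i) ∩ subsetClosure (F j), ¬ (Qi ∩ Qj ⊆ X)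
  availability : ∀ i, ∀ Fi ∈ F i, ∃ Qi ∈ Q i, Fi ∩ Qi = ∅

/-- `K` is a kernel for `i`: it meets every quorum of `i`. -/
def IsKernel (Q : P → Set (Set P)) (i : P) (K : Set P) : Prop :=
  ∀ Qi ∈ Q i, (K ∩ Qi).Nonempty

/-- `i` is wise when `B` is the set of parties that fail: it is correct and foresees `B`. -/
def Wise (F : P → Set (Set P)) (B : Set P) (i : P) : Prop :=
  i ∉ B ∧ B ∈ subsetClosure (F i)

/-- A guild: a set of wise parties that contains a quorum for each of its members. -/
structure IsGuild (F Q : P → Set (Set P)) (B G : Set P) : Prop where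
  wisdom : ∀ i ∈ G, Wise F B i
  closure : ∀ i ∈ G, ∃ Qi ∈ Q i, Qi ⊆ G

/-- The maximal guild, i.e. the union of all guilds. -/
def maxGuild (F Q : P → Set (Set P)) (B : Set P) : Set P :=
  ⋃₀ {G | IsGuild F Q B G}

/-- The union of all guilds is a guild (possibly the empty one). -/
theorem isGuild_maxGuild (F Q : P → Set (Set P)) (B : Set P) :
    IsGuild F Q B (maxGuild F Q B) := by
  constructor
  · rintro i ⟨G, hG, hi⟩
    exact hG.wisdom i hi
  · rintro i ⟨G, hG, hi⟩
    obtain ⟨Qi, hQ, hsub⟩ := hG.closure i hi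
    exact ⟨Qi, hQ, fun x hx => ⟨G, hG, hsub hx⟩⟩

/-- Every guild is contained in the maximal guild. -/
theorem IsGuild.subset_maxGuild {F Q : P → Set (Set P)} {B G : Set P}
    (hG : IsGuild F Q B G) : G ⊆ maxGuild F Q B :=
  fun _ hx => ⟨G, hG, hx⟩

end Trust

/-! ### The protocol as a transition system -/

/-- Messages on the point-to-point links. The links are authenticated, so the sender of a message
is given by the link and is not repeated in the message. -/
inductive Msg (P V : Type*)
  | distributeS (A : Set (P × V))
  | ack
  | ready
  | confirm
  | distributeT (A : Set (P × V))

/-- Local state of a correct party. Besides the variables `S`, `T`, `U`, `sentT` of the protocol it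
records the input, the parties from which messages of each kind have been received, and which of
the one-time steps have been taken. -/
structure LocalState (P V : Type*) where
  input : Option V
  S : Set (P × V)
  T : Set (P × V)
  U : Set (P × V)
  ackFrom : Set P
  readyFrom : Set P
  confirmFrom : Set P
  distTFrom : Set P
  sentS : Bool
  sentReady : Bool
  sentConfirm : Bool
  sentT : Bool
  delivered : Bool

/-- Global state: the local states (meaningful for the correct parties only), the messages
`(source, destination, content)` sent so far by correct parties, and those of them which have been
received so far by correct parties. -/
structure GlobalState (P V : Type*) where
  loc : P → LocalState P V
  sent : Set (P × P × Msg P V)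
  received : Set (P × P × Msg P V)

/-- The events at the correct parties. The steps of the faulty parties appear only through the
messages received from them and through what is arb-delivered from them. -/
inductive Event (P V : Type*)
  | idle
  /-- `p` ag-proposes `v`, and therefore arb-broadcasts `(p, v)` -/
  | propose (p : P) (v : V)
  /-- `p` arb-delivers the pair `(q, v)` from the sender `q` -/
  | arbDeliver (p q : P) (v : V)
  /-- `dst` receives and handles a message from `src` -/
  | receive (src dst : P) (m : Msg P V)
  | sendS (p : P)
  | sendReady (p : P)
  | sendConfirm (p : P)
  | sendT (p : P)
  | agDeliver (p : P)

section Protocol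

variable {P V : Type*}

def LocalState.init : LocalState P V where
  input := none
  S := ∅
  T := ∅
  U := ∅
  ackFrom := ∅
  readyFrom := ∅
  confirmFrom := ∅
  distTFrom := ∅
  sentS := false
  sentReady := false
  sentConfirm := false
  sentT := false
  delivered := false

def GlobalState.init : GlobalState P V where
  loc := fun _ => LocalState.init
  sent := ∅
  received := ∅

/-- The condition under which a party in local state `s` handles a message. A message whose
condition fails remains pending. -/
def Accepts (s : LocalState P V) : Msg P V → Prop
  | .distributeS A => A ⊆ s.S ∧ s.sentT = false
  | .distributeT A => A ⊆ s.S
  | _ => True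

/-- `X` contains all members of some quorum of `p`. -/
def HasQuorum (Q : P → Set (Set P)) (p : P) (X : Set P) : Prop :=
  ∃ Qp ∈ Q p, Qp ⊆ X

/-- `X` contains all members of some kernel for `p`. -/
def HasKernel (Q : P → Set (Set P)) (p : P) (X : Set P) : Prop :=
  ∃ K, IsKernel Q p K ∧ K ⊆ X

/-- `Enabled Q B g e`: the event `e` can happen in the state `g`, where `B` is the set of faulty
parties. A message from a faulty party may arrive at any time with any content. A message from a
correct party must have been sent, and it is received at most once. -/
def Enabled (Q : P → Set (Set P)) (B : Set P) (g : GlobalState P V) : Event P V → Prop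
  | .idle => True
  | .propose p _ => p ∉ B ∧ (g.loc p).input = none
  | .arbDeliver p _ _ => p ∉ B
  | .receive src dst m =>
      dst ∉ B ∧ (src ∈ B ∨ ((src, dst, m) ∈ g.sent ∧ (src, dst, m) ∉ g.received)) ∧
        Accepts (g.loc dst) m
  | .sendS p =>
      p ∉ B ∧ (g.loc p).sentS = false ∧ HasQuorum Q p {q | ∃ v, (q, v) ∈ (g.loc p).S}
  | .sendReady p =>
      p ∉ B ∧ (g.loc p).sentReady = false ∧ HasQuorum Q p (g.loc p).ackFrom
  | .sendConfirm p =>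
      p ∉ B ∧ (g.loc p).sentConfirm = false ∧
        (HasQuorum Q p (g.loc p).readyFrom ∨ HasKernel Q p (g.loc p).confirmFrom)
  | .sendT p =>
      p ∉ B ∧ (g.loc p).sentT = false ∧ HasQuorum Q p (g.loc p).confirmFrom
  | .agDeliver p =>
      p ∉ B ∧ (g.loc p).delivered = false ∧ HasQuorum Q p (g.loc p).distTFrom

/-- The messages put on the links when `p` sends `m` to all parties (itself included). -/
def toAll (p : P) (m : Msg P V) : Set (P × P × Msg P V) :=
  {x | ∃ q, x = (p, q, m)}

/-- The effect of a received message on the local state of the receiver. -/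
def LocalState.handle (s : LocalState P V) (src : P) : Msg P V → LocalState P V
  | .distributeS A => { s with T := s.T ∪ A }
  | .ack => { s with ackFrom := insert src s.ackFrom }
  | .ready => { s with readyFrom := insert src s.readyFrom }
  | .confirm => { s with confirmFrom := insert src s.confirmFrom }
  | .distributeT A => { s with U := s.U ∪ A, distTFrom := insert src s.distTFrom }

/-- The messages sent by `dst` when it handles a message from `src`: an acknowledgement of each
accepted `distributeS` message. -/
def replies (src dst : P) : Msg P V → Set (P × P × Msg P V)
  | .distributeS _ => {(dst, src, .ack)}
  | _ => ∅

/-- The effect of an event on the global state. -/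
def step [DecidableEq P] (g : GlobalState P V) : Event P V → GlobalState P V
  | .idle => g
  | .propose p v =>
      { g with loc := Function.update g.loc p { g.loc p with input := some v } }
  | .arbDeliver p q v =>
      { g with loc := Function.update g.loc p { g.loc p with S := insert (q, v) (g.loc p).S } }
  | .receive src dst m =>
      { loc := Function.update g.loc dst ((g.loc dst).handle src m)
        sent := g.sent ∪ replies src dst m
        received := insert (src, dst, m) g.received }
  | .sendS p =>
      { g with
        loc := Function.update g.loc p { g.loc p with sentS := true }
        sent := g.sent ∪ toAll p (.distributeS (g.loc p).S) }
  | .sendReady p =>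
      { g with
        loc := Function.update g.loc p { g.loc p with sentReady := true }
        sent := g.sent ∪ toAll p .ready }
  | .sendConfirm p =>
      { g with
        loc := Function.update g.loc p { g.loc p with sentConfirm := true }
        sent := g.sent ∪ toAll p .confirm }
  | .sendT p =>
      { g with
        loc := Function.update g.loc p { g.loc p with sentT := true }
        sent := g.sent ∪ toAll p (.distributeT (g.loc p).T) }
  | .agDeliver p =>
      { g with loc := Function.update g.loc p { g.loc p with delivered := true } }

/-- The events that must not be postponed forever: the protocol steps of the correct parties and
the handling of messages sent by correct parties. -/
def Obligatory (B : Set P) : Event P V → Prop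
  | .idle => False
  | .propose _ _ => False
  | .arbDeliver _ _ _ => False
  | .receive src _ _ => src ∉ B
  | _ => True

end Protocol

/-! ### Executions -/

/-- An infinite sequence of states and events: `ev n` leads from `st n` to `st (n + 1)`. (A finite
run is continued by `idle` events.) -/
structure Trace (P V : Type*) where
  st : ℕ → GlobalState P V
  ev : ℕ → Event P V

namespace Trace

variable {P V : Type*}

/-- `p` ag-proposes `v`. -/
def Proposes (t : Trace P V) (p : P) (v : V) : Prop :=
  ∃ n, t.ev n = .propose p v

/-- `p` arb-delivers `(q, v)`. -/
def ArbDelivers (t : Trace P V) (p q : P) (v : V) : Prop :=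
  ∃ n, t.ev n = .arbDeliver p q v

/-- `p` sends a `distributeS` message with content `A`, i.e. `A` is its candidate set. -/
def Distributes (t : Trace P V) (p : P) (A : Set (P × V)) : Prop :=
  ∃ n, t.ev n = .sendS p ∧ ((t.st n).loc p).S = A

/-- `p` ag-delivers the set `A`. -/
def Delivers (t : Trace P V) (p : P) (A : Set (P × V)) : Prop :=
  ∃ n, t.ev n = .agDeliver p ∧ ((t.st n).loc p).U = A

/-- The arb-broadcast (part of `propose`) and `arbDeliver` events of the trace are those of an
asymmetric reliable broadcast, with one instance for each sender. -/
structure IsReliableBroadcast (F Q : P → Set (Set P)) (B : Set P) (t : Trace P V) : Prop where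
  /-- what a correct sender broadcasts is eventually delivered in the maximal guild -/
  validity : ∀ q, q ∉ B → ∀ v, t.Proposes q v → ∀ p ∈ maxGuild F Q B, t.ArbDelivers p q v
  /-- in executions with a guild, wise parties deliver the same from each sender -/
  consistency : (maxGuild F Q B).Nonempty → ∀ p p', Wise F B p → Wise F B p' →
    ∀ q v v', t.ArbDelivers p q v → t.ArbDelivers p' q v' → v = v'
  /-- no message is delivered twice by a correct party -/
  noDuplication : ∀ p, p ∉ B → ∀ q v m n,
    t.ev m = .arbDeliver p q v → t.ev n = .arbDeliver p q v → m = n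
  /-- in executions with a guild, what a wise party delivers from a correct sender has been
  broadcast before by that sender -/
  integrity : (maxGuild F Q B).Nonempty → ∀ p, Wise F B p → ∀ q, q ∉ B → ∀ v n,
    t.ev n = .arbDeliver p q v → ∃ m < n, t.ev m = .propose q v
  /-- if a wise party delivers something from a sender, all of the maximal guild eventually do -/
  totality : ∀ p, Wise F B p → ∀ q v, t.ArbDelivers p q v →
    ∀ p' ∈ maxGuild F Q B, ∃ v', t.ArbDelivers p' q v'

/-- `t` is an execution of the protocol with set of faulty parties `B`: it starts in the initial
state, correct parties follow the protocol, no obligatory event stays enabled forever from some time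
on without happening (reliable links), and the broadcast used is an asymmetric reliable broadcast. -/
structure IsExecution [DecidableEq P] (F Q : P → Set (Set P)) (B : Set P) (t : Trace P V) :
    Prop where
  start : t.st 0 = GlobalState.init
  enabled : ∀ n, Enabled Q B (t.st n) (t.ev n)
  next : ∀ n, t.st (n + 1) = step (t.st n) (t.ev n)
  fair : ∀ e, Obligatory B e → ∀ n, (∀ m, n ≤ m → Enabled Q B (t.st m) e) → ∃ m, n ≤ m ∧ t.ev m = e
  broadcast : t.IsReliableBroadcast F Q B

/-! ### The properties of an asymmetric gather -/

/-- Common core: there is a set `S⁺ = {(q, x q) | q ∈ Qi}` of values ag-proposed by the members of a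
quorum `Qi` of a member of the maximal guild which is contained in every set that is ag-delivered
in the maximal guild. (There is no ag-proposed value of a faulty party to compare `x q` with.) -/
def CommonCore (F Q : P → Set (Set P)) (B : Set P) (t : Trace P V) : Prop :=
  ∃ i ∈ maxGuild F Q B, ∃ Qi ∈ Q i, ∃ x : P → V,
    (∀ q ∈ Qi, q ∉ B → t.Proposes q (x q)) ∧
    ∀ p ∈ maxGuild F Q B, ∀ A, t.Delivers p A → (fun q => (q, x q)) '' Qi ⊆ A

/-- The candidate set `C` distributed by some member `i` of the maximal guild contains the values of
a quorum of `i` and is contained in every set that is ag-delivered in the maximal guild. -/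
def CandidateCore (F Q : P → Set (Set P)) (B : Set P) (t : Trace P V) : Prop :=
  ∃ i ∈ maxGuild F Q B, ∃ C, t.Distributes i C ∧
    (∃ Qi ∈ Q i, ∃ x : P → V,
      (∀ q ∈ Qi, q ∉ B → t.Proposes q (x q)) ∧ (fun q => (q, x q)) '' Qi ⊆ C) ∧
    ∀ p ∈ maxGuild F Q B, ∀ A, t.Delivers p A → C ⊆ A

def Validity (F Q : P → Set (Set P)) (B : Set P) (t : Trace P V) : Prop :=
  ∀ p ∈ maxGuild F Q B, ∀ A, t.Delivers p A →
    ∀ q x, (q, x) ∈ A → Wise F B q → t.Proposes q x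

def Agreement (F Q : P → Set (Set P)) (B : Set P) (t : Trace P V) : Prop :=
  ∀ p ∈ maxGuild F Q B, ∀ p' ∈ maxGuild F Q B, ∀ A A', t.Delivers p A → t.Delivers p' A' →
    ∀ q x x', (q, x) ∈ A → (q, x') ∈ A' → x = x'

end Trace

end AsymGather

/-! Safety rests on one invariant: a correct party absorbs into `T` and `U` only sets already
contained in its `S` (`T_U_subset_S`). For members of the maximal guild, validity and agreement
therefore reduce to integrity and consistency of the broadcast.

Termination: totality and consistency of the broadcast make whatever one guild member has collected
eventually known to all of them (`eventually_subset_S`), so the inclusion guards on messages inside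
the guild eventually hold. The only remaining obstacle is `sentT`, which stops acknowledgements. If
no guild member ever set it, all candidate sets would be acknowledged in the guild, and `ready`,
`confirm` and `distributeT` would follow, a contradiction (`exists_mem_sendT_of_sendS`). So some
member sends `distributeT`. The correct part of the quorum that confirmed to it is a kernel for
every guild member, so all of them confirm (`exists_sendConfirm_of_sendT`), and then all send
`distributeT` and deliver.

Common core: a delivery in the guild is traced back to a guild member `p` that sent `ready`
(`exists_mem_sendReady_of_agDeliver`). The quorum that acknowledged the candidate set of `p` meets
the quorum behind any delivery in the guild in a correct party, not necessarily in the guild. That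
party acknowledged before it sent its `T`, so the candidate set lies in this `T` and hence in the
output (`exists_candidate_subset`). -/

namespace AsymGather

/-! ### Growth of local states -/

/-- The order in which local states grow during an execution. -/
structure LocalState.Le {P V : Type*} (s s' : LocalState P V) : Prop where
  S : s.S ⊆ s'.S
  T : s.T ⊆ s'.T
  U : s.U ⊆ s'.U
  ackFrom : s.ackFrom ⊆ s'.ackFrom
  readyFrom : s.readyFrom ⊆ s'.readyFrom
  confirmFrom : s.confirmFrom ⊆ s'.confirmFrom
  distTFrom : s.distTFrom ⊆ s'.distTFrom
  sentS : s.sentS = true → s'.sentS = true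
  sentT : s.sentT = true → s'.sentT = true

namespace LocalState.Le

variable {P V : Type*} {s s' s'' : LocalState P V}

theorem refl (s : LocalState P V) : s.Le s := by
  constructor <;> simp

theorem trans (h : s.Le s') (h' : s'.Le s'') : s.Le s'' where
  S := h.S.trans h'.S
  T := h.T.trans h'.T
  U := h.U.trans h'.U
  ackFrom := h.ackFrom.trans h'.ackFrom
  readyFrom := h.readyFrom.trans h'.readyFrom
  confirmFrom := h.confirmFrom.trans h'.confirmFrom
  distTFrom := h.distTFrom.trans h'.distTFrom
  sentS := fun hs => h'.sentS (h.sentS hs)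
  sentT := fun hs => h'.sentT (h.sentT hs)

theorem handle (s : LocalState P V) (q : P) (m : Msg P V) : s.Le (s.handle q m) := by
  cases m <;> constructor <;> simp [LocalState.handle]

end LocalState.Le

/-! ### One step of the transition system: what grows, and which event causes each change -/

section Step

variable {P V : Type*} [DecidableEq P]

theorem le_update (f : P → LocalState P V) (p q : P) {s : LocalState P V} (h : (f p).Le s) :
    (f q).Le (Function.update f p s q) := by
  by_cases hq : q = p
  · subst hq; simpa using h
  · simpa [hq] using LocalState.Le.refl (f q)

theorem loc_le_step (g : GlobalState P V) (e : Event P V) (p : P) :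
    (g.loc p).Le ((step g e).loc p) := by
  cases e with
  | idle => exact LocalState.Le.refl _
  | receive q r m => exact le_update _ _ _ (LocalState.Le.handle _ _ _)
  | _ => refine le_update _ _ _ ?_; constructor <;> simp

theorem sent_subset_step (g : GlobalState P V) (e : Event P V) : g.sent ⊆ (step g e).sent := by
  cases e <;> simp [step]

variable {g : GlobalState P V} {e : Event P V} {p q : P} {v : V} {A : Set (P × V)}

theorem distributeS_mem_sent_step (h : (p, q, Msg.distributeS A) ∈ (step g e).sent) :
    (p, q, Msg.distributeS A) ∈ g.sent ∨ e = .sendS p ∧ (g.loc p).S = A := by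
  cases e with
  | receive r s m => cases m <;> simp_all [step, replies]
  | _ => simp_all [step, toAll] <;> grind

theorem distributeT_mem_sent_step (h : (p, q, Msg.distributeT A) ∈ (step g e).sent) :
    (p, q, Msg.distributeT A) ∈ g.sent ∨ e = .sendT p ∧ (g.loc p).T = A := by
  cases e with
  | receive r s m => cases m <;> simp_all [step, replies]
  | _ => simp_all [step, toAll] <;> grind

theorem ack_mem_sent_step (h : (p, q, (Msg.ack : Msg P V)) ∈ (step g e).sent) :
    (p, q, (Msg.ack : Msg P V)) ∈ g.sent ∨ ∃ A, e = .receive q p (.distributeS A) := by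
  cases e with
  | receive r s m => cases m <;> simp_all [step, replies]; grind
  | _ => simp_all [step, toAll]

theorem ready_mem_sent_step (h : (p, q, (Msg.ready : Msg P V)) ∈ (step g e).sent) :
    (p, q, (Msg.ready : Msg P V)) ∈ g.sent ∨ e = .sendReady p := by
  cases e with
  | receive r s m => cases m <;> simp_all [step, replies]
  | _ => simp_all [step, toAll] <;> grind

theorem confirm_mem_sent_step (h : (p, q, (Msg.confirm : Msg P V)) ∈ (step g e).sent) :
    (p, q, (Msg.confirm : Msg P V)) ∈ g.sent ∨ e = .sendConfirm p := by
  cases e with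
  | receive r s m => cases m <;> simp_all [step, replies]
  | _ => simp_all [step, toAll] <;> grind

theorem mem_received_step {m : Msg P V} (h : (q, p, m) ∈ (step g e).received) :
    (q, p, m) ∈ g.received ∨ e = .receive q p m := by
  cases e <;> simp_all [step]; grind

theorem mem_S_step (h : (q, v) ∈ ((step g e).loc p).S) :
    (q, v) ∈ (g.loc p).S ∨ e = .arbDeliver p q v := by
  cases e with
  | receive r s m => cases m <;> simp_all [step, LocalState.handle, Function.update_apply] <;> grind
  | _ => simp_all [step, Function.update_apply] <;> grind

theorem mem_ackFrom_step (h : q ∈ ((step g e).loc p).ackFrom) :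
    q ∈ (g.loc p).ackFrom ∨ e = .receive q p .ack := by
  cases e with
  | receive r s m => cases m <;> simp_all [step, LocalState.handle, Function.update_apply] <;> grind
  | _ => simp_all [step, Function.update_apply] <;> grind

theorem mem_readyFrom_step (h : q ∈ ((step g e).loc p).readyFrom) :
    q ∈ (g.loc p).readyFrom ∨ e = .receive q p .ready := by
  cases e with
  | receive r s m => cases m <;> simp_all [step, LocalState.handle, Function.update_apply] <;> grind
  | _ => simp_all [step, Function.update_apply] <;> grind

theorem mem_confirmFrom_step (h : q ∈ ((step g e).loc p).confirmFrom) :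
    q ∈ (g.loc p).confirmFrom ∨ e = .receive q p .confirm := by
  cases e with
  | receive r s m => cases m <;> simp_all [step, LocalState.handle, Function.update_apply] <;> grind
  | _ => simp_all [step, Function.update_apply] <;> grind

theorem mem_distTFrom_step (h : q ∈ ((step g e).loc p).distTFrom) :
    q ∈ (g.loc p).distTFrom ∨ ∃ A, e = .receive q p (.distributeT A) := by
  cases e with
  | receive r s m => cases m <;> simp_all [step, LocalState.handle, Function.update_apply] <;> grind
  | _ => simp_all [step, Function.update_apply] <;> grind

theorem sentS_step (h : ((step g e).loc p).sentS = true) :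
    (g.loc p).sentS = true ∨ e = .sendS p := by
  cases e with
  | receive r s m => cases m <;> simp_all [step, LocalState.handle, Function.update_apply] <;> grind
  | _ => simp_all [step, Function.update_apply] <;> grind

theorem sentReady_step (h : ((step g e).loc p).sentReady = true) :
    (g.loc p).sentReady = true ∨ e = .sendReady p := by
  cases e with
  | receive r s m => cases m <;> simp_all [step, LocalState.handle, Function.update_apply] <;> grind
  | _ => simp_all [step, Function.update_apply] <;> grind

theorem sentConfirm_step (h : ((step g e).loc p).sentConfirm = true) :
    (g.loc p).sentConfirm = true ∨ e = .sendConfirm p := by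
  cases e with
  | receive r s m => cases m <;> simp_all [step, LocalState.handle, Function.update_apply] <;> grind
  | _ => simp_all [step, Function.update_apply] <;> grind

theorem sentT_step (h : ((step g e).loc p).sentT = true) :
    (g.loc p).sentT = true ∨ e = .sendT p := by
  cases e with
  | receive r s m => cases m <;> simp_all [step, LocalState.handle, Function.update_apply] <;> grind
  | _ => simp_all [step, Function.update_apply] <;> grind

theorem delivered_step (h : ((step g e).loc p).delivered = true) :
    (g.loc p).delivered = true ∨ e = .agDeliver p := by
  cases e with
  | receive r s m => cases m <;> simp_all [step, LocalState.handle, Function.update_apply] <;> grind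
  | _ => simp_all [step, Function.update_apply] <;> grind

/-- The inclusion guards in `Accepts` are exactly what preserves this invariant when a set is
absorbed; every other event leaves `T` and `U` alone and can only enlarge `S`. -/
theorem T_U_subset_S_step {Q : P → Set (Set P)} {B : Set P} (he : Enabled Q B g e)
    (h : (g.loc p).T ⊆ (g.loc p).S ∧ (g.loc p).U ⊆ (g.loc p).S) :
    ((step g e).loc p).T ⊆ ((step g e).loc p).S ∧ ((step g e).loc p).U ⊆ ((step g e).loc p).S := by
  cases e with
  | receive r s m =>
    by_cases hp : p = s
    · subst hp
      have ha := he.2.2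
      cases m <;> simp_all [step, LocalState.handle, Accepts]
    · simpa [step, hp] using h
  | arbDeliver r s w =>
    by_cases hp : p = r
    · subst hp
      simpa [step] using ⟨h.1.trans (Set.subset_insert _ _), h.2.trans (Set.subset_insert _ _)⟩
    · simpa [step, hp] using h
  | _ => simp_all [step, Function.update_apply] <;> grind

end Step

/-! ### General facts about time and monotonicity -/

/-- Backward tracing: `Φ` is a fact about the state, `Ψ` the event that alone can create it. The
strict inequality is what later permits induction on time. -/
theorem exists_lt_of_step {Φ Ψ : ℕ → Prop} (h0 : ¬ Φ 0) (hs : ∀ n, Φ (n + 1) → Φ n ∨ Ψ n)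
    {n : ℕ} (h : Φ n) : ∃ m < n, Ψ m := by
  induction n with
  | zero => exact absurd h h0
  | succ n ih =>
    rcases hs n h with h | h
    · obtain ⟨m, hm, hΨ⟩ := ih h
      exact ⟨m, hm.trans n.lt_succ_self, hΨ⟩
    · exact ⟨n, n.lt_succ_self, h⟩

/-- A finite set each of whose elements eventually belongs to a growing set is eventually
contained in it. -/
theorem exists_subset_of_monotone {α : Type*} {s : ℕ → Set α} (hs : Monotone s) {X : Set α}
    (hX : X.Finite) (h : ∀ x ∈ X, ∃ n, x ∈ s n) : ∃ n, X ⊆ s n := by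
  induction X, hX using Set.Finite.induction_on with
  | empty => exact ⟨0, Set.empty_subset _⟩
  | @insert a X _ _ ih =>
    obtain ⟨n, hn⟩ := ih fun x hx => h x (Set.mem_insert_of_mem _ hx)
    obtain ⟨m, hm⟩ := h a (Set.mem_insert _ _)
    refine ⟨max m n, Set.insert_subset (hs (le_max_left _ _) hm) ?_⟩
    exact hn.trans (hs (le_max_right _ _))

theorem HasQuorum.mono {P : Type*} {Q : P → Set (Set P)} {p : P} {X Y : Set P}
    (h : HasQuorum Q p X) (hXY : X ⊆ Y) : HasQuorum Q p Y := by
  obtain ⟨q, hq, hX⟩ := h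
  exact ⟨q, hq, hX.trans hXY⟩

theorem HasKernel.mono {P : Type*} {Q : P → Set (Set P)} {p : P} {X Y : Set P}
    (h : HasKernel Q p X) (hXY : X ⊆ Y) : HasKernel Q p Y := by
  obtain ⟨q, hq, hX⟩ := h
  exact ⟨q, hq, hX.trans hXY⟩

namespace Trace.IsExecution

variable {P V : Type*} [DecidableEq P] {F Q : P → Set (Set P)} {B : Set P} {t : Trace P V}
  {p q : P} {v : V} {A : Set (P × V)} {m n : ℕ}

/-! ### Persistence along an execution -/

section Monotone

theorem loc_le (ht : t.IsExecution F Q B) (p : P) (h : m ≤ n) :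
    ((t.st m).loc p).Le ((t.st n).loc p) := by
  induction n, h using Nat.le_induction with
  | base => exact LocalState.Le.refl _
  | succ n _ ih => rw [ht.next]; exact ih.trans (loc_le_step _ _ _)

theorem sent_mono (ht : t.IsExecution F Q B) : Monotone fun n => (t.st n).sent :=
  monotone_nat_of_le_succ fun n => by
    rw [ht.next]; exact sent_subset_step _ _

theorem sent_of_event (ht : t.IsExecution F Q B) {e : Event P V} (he : t.ev m = e) (h : m < n)
    {x : P × P × Msg P V} (hx : x ∈ (step (t.st m) e).sent) : x ∈ (t.st n).sent :=
  ht.sent_mono (Nat.succ_le_of_lt h) (by simpa only [ht.next, he] using hx)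

theorem loc_le_of_event (ht : t.IsExecution F Q B) {e : Event P V} (he : t.ev m = e) (h : m < n)
    (p : P) : ((step (t.st m) e).loc p).Le ((t.st n).loc p) := by
  rw [← he, ← ht.next]; exact ht.loc_le p (Nat.succ_le_of_lt h)

end Monotone

/-! ### Every fact about a state goes back to an earlier event -/

section Origin

theorem exists_distributeS (ht : t.IsExecution F Q B)
    (h : (p, q, Msg.distributeS A) ∈ (t.st n).sent) :
    ∃ m < n, t.ev m = .sendS p ∧ ((t.st m).loc p).S = A :=
  exists_lt_of_step (Φ := fun n => (p, q, Msg.distributeS A) ∈ (t.st n).sent)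
    (by simp [ht.start, GlobalState.init])
    (fun n hn => distributeS_mem_sent_step (by rwa [← ht.next])) h

theorem exists_distributeT (ht : t.IsExecution F Q B)
    (h : (p, q, Msg.distributeT A) ∈ (t.st n).sent) :
    ∃ m < n, t.ev m = .sendT p ∧ ((t.st m).loc p).T = A :=
  exists_lt_of_step (Φ := fun n => (p, q, Msg.distributeT A) ∈ (t.st n).sent)
    (by simp [ht.start, GlobalState.init])
    (fun n hn => distributeT_mem_sent_step (by rwa [← ht.next])) h

theorem exists_ack (ht : t.IsExecution F Q B) (h : (p, q, Msg.ack) ∈ (t.st n).sent) :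
    ∃ m < n, ∃ A, t.ev m = .receive q p (.distributeS A) :=
  exists_lt_of_step (Φ := fun n => (p, q, Msg.ack) ∈ (t.st n).sent)
    (by simp [ht.start, GlobalState.init])
    (fun n hn => ack_mem_sent_step (by rwa [← ht.next])) h

theorem exists_ready (ht : t.IsExecution F Q B) (h : (p, q, Msg.ready) ∈ (t.st n).sent) :
    ∃ m < n, t.ev m = .sendReady p :=
  exists_lt_of_step (Φ := fun n => (p, q, Msg.ready) ∈ (t.st n).sent)
    (by simp [ht.start, GlobalState.init])
    (fun n hn => ready_mem_sent_step (by rwa [← ht.next])) h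

theorem exists_confirm (ht : t.IsExecution F Q B) (h : (p, q, Msg.confirm) ∈ (t.st n).sent) :
    ∃ m < n, t.ev m = .sendConfirm p :=
  exists_lt_of_step (Φ := fun n => (p, q, Msg.confirm) ∈ (t.st n).sent)
    (by simp [ht.start, GlobalState.init])
    (fun n hn => confirm_mem_sent_step (by rwa [← ht.next])) h

theorem exists_receive (ht : t.IsExecution F Q B) {c : Msg P V}
    (h : (q, p, c) ∈ (t.st n).received) : ∃ m < n, t.ev m = .receive q p c :=
  exists_lt_of_step (Φ := fun n => (q, p, c) ∈ (t.st n).received)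
    (by simp [ht.start, GlobalState.init])
    (fun n hn => mem_received_step (by rwa [← ht.next])) h

theorem exists_arbDeliver (ht : t.IsExecution F Q B) (h : (q, v) ∈ ((t.st n).loc p).S) :
    ∃ m < n, t.ev m = .arbDeliver p q v :=
  exists_lt_of_step (Φ := fun n => (q, v) ∈ ((t.st n).loc p).S)
    (by simp [ht.start, GlobalState.init, LocalState.init])
    (fun n hn => mem_S_step (by rwa [← ht.next])) h

theorem exists_receive_ack (ht : t.IsExecution F Q B) (h : q ∈ ((t.st n).loc p).ackFrom) :
    ∃ m < n, t.ev m = .receive q p .ack :=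
  exists_lt_of_step (Φ := fun n => q ∈ ((t.st n).loc p).ackFrom)
    (by simp [ht.start, GlobalState.init, LocalState.init])
    (fun n hn => mem_ackFrom_step (by rwa [← ht.next])) h

theorem exists_receive_ready (ht : t.IsExecution F Q B) (h : q ∈ ((t.st n).loc p).readyFrom) :
    ∃ m < n, t.ev m = .receive q p .ready :=
  exists_lt_of_step (Φ := fun n => q ∈ ((t.st n).loc p).readyFrom)
    (by simp [ht.start, GlobalState.init, LocalState.init])
    (fun n hn => mem_readyFrom_step (by rwa [← ht.next])) h

theorem exists_receive_confirm (ht : t.IsExecution F Q B)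
    (h : q ∈ ((t.st n).loc p).confirmFrom) : ∃ m < n, t.ev m = .receive q p .confirm :=
  exists_lt_of_step (Φ := fun n => q ∈ ((t.st n).loc p).confirmFrom)
    (by simp [ht.start, GlobalState.init, LocalState.init])
    (fun n hn => mem_confirmFrom_step (by rwa [← ht.next])) h

theorem exists_receive_distributeT (ht : t.IsExecution F Q B)
    (h : q ∈ ((t.st n).loc p).distTFrom) :
    ∃ m < n, ∃ A, t.ev m = .receive q p (.distributeT A) :=
  exists_lt_of_step (Φ := fun n => q ∈ ((t.st n).loc p).distTFrom)
    (by simp [ht.start, GlobalState.init, LocalState.init])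
    (fun n hn => mem_distTFrom_step (by rwa [← ht.next])) h

theorem exists_sendS (ht : t.IsExecution F Q B) (h : ((t.st n).loc p).sentS = true) :
    ∃ m < n, t.ev m = .sendS p :=
  exists_lt_of_step (Φ := fun n => ((t.st n).loc p).sentS = true)
    (by simp [ht.start, GlobalState.init, LocalState.init])
    (fun n hn => sentS_step (by rwa [← ht.next])) h

theorem exists_sendReady (ht : t.IsExecution F Q B) (h : ((t.st n).loc p).sentReady = true) :
    ∃ m < n, t.ev m = .sendReady p :=
  exists_lt_of_step (Φ := fun n => ((t.st n).loc p).sentReady = true)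
    (by simp [ht.start, GlobalState.init, LocalState.init])
    (fun n hn => sentReady_step (by rwa [← ht.next])) h

theorem exists_sendConfirm (ht : t.IsExecution F Q B)
    (h : ((t.st n).loc p).sentConfirm = true) : ∃ m < n, t.ev m = .sendConfirm p :=
  exists_lt_of_step (Φ := fun n => ((t.st n).loc p).sentConfirm = true)
    (by simp [ht.start, GlobalState.init, LocalState.init])
    (fun n hn => sentConfirm_step (by rwa [← ht.next])) h

theorem exists_sendT (ht : t.IsExecution F Q B) (h : ((t.st n).loc p).sentT = true) :
    ∃ m < n, t.ev m = .sendT p :=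
  exists_lt_of_step (Φ := fun n => ((t.st n).loc p).sentT = true)
    (by simp [ht.start, GlobalState.init, LocalState.init])
    (fun n hn => sentT_step (by rwa [← ht.next])) h

theorem exists_agDeliver (ht : t.IsExecution F Q B)
    (h : ((t.st n).loc p).delivered = true) : ∃ m < n, t.ev m = .agDeliver p :=
  exists_lt_of_step (Φ := fun n => ((t.st n).loc p).delivered = true)
    (by simp [ht.start, GlobalState.init, LocalState.init])
    (fun n hn => delivered_step (by rwa [← ht.next])) h

theorem T_U_subset_S (ht : t.IsExecution F Q B) (n : ℕ) (p : P) :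
    ((t.st n).loc p).T ⊆ ((t.st n).loc p).S ∧ ((t.st n).loc p).U ⊆ ((t.st n).loc p).S := by
  induction n with
  | zero => simp [ht.start, GlobalState.init, LocalState.init]
  | succ n ih => rw [ht.next]; exact T_U_subset_S_step (ht.enabled n) ih

end Origin

/-- The flag `sentS` persists and blocks a second event. This matters because an acknowledgement
does not name the set it answers: uniqueness ensures that all acknowledgements to `p` concern the
same candidate set. -/
theorem sendS_unique (ht : t.IsExecution F Q B) (hm : t.ev m = .sendS p)
    (hn : t.ev n = .sendS p) : m = n := by
  have key : ∀ {m n}, t.ev m = .sendS p → t.ev n = .sendS p → ¬ m < n := by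
    intro m n hm hn hlt
    have h1 := (ht.loc_le_of_event hm hlt p).sentS (by simp [step])
    have h2 := ht.enabled n
    rw [hn] at h2
    simp [h2.2.1] at h1
  exact le_antisymm (not_lt.1 (key hn hm)) (not_lt.1 (key hm hn))

/-! ### Consequences of fairness -/

section Progress

/-- Reliable links: a message between correct parties which is acceptable from some time on is
received. -/
theorem eventually_receive (ht : t.IsExecution F Q B) (hq : q ∉ B) (hp : p ∉ B) {c : Msg P V}
    (hc : (q, p, c) ∈ (t.st n).sent) (ha : ∃ k, ∀ i, k ≤ i → Accepts ((t.st i).loc p) c) :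
    ∃ i, t.ev i = .receive q p c := by
  by_contra hno
  obtain ⟨k, hk⟩ := ha
  -- A message never received stays out of `received`, so from time `max k n` on, when it is both
  -- sent and acceptable, its reception would be enabled forever.
  obtain ⟨i, -, hi⟩ := ht.fair (.receive q p c) hq (max k n) fun i hi =>
    ⟨hp, .inr ⟨ht.sent_mono ((le_max_right _ _).trans hi) hc, fun hr => hno <| by
      obtain ⟨j, -, hj⟩ := ht.exists_receive hr
      exact ⟨j, hj⟩⟩, hk i ((le_max_left _ _).trans hi)⟩
  exact hno ⟨i, hi⟩

/-- The quorum condition is monotone, and if the step were never taken its flag would stay false;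
the step would then be enabled forever, against fairness. The other one-time steps below follow the
same pattern. -/
theorem eventually_sendS (ht : t.IsExecution F Q B) (hp : p ∉ B)
    (h : HasQuorum Q p {q | ∃ v, (q, v) ∈ ((t.st n).loc p).S}) : ∃ i, t.ev i = .sendS p := by
  by_contra hno
  obtain ⟨i, -, hi⟩ := ht.fair (.sendS p) trivial n fun i hi =>
    ⟨hp, by
      by_contra hs
      obtain ⟨j, -, hj⟩ := ht.exists_sendS (by simpa using hs)
      exact hno ⟨j, hj⟩, h.mono fun _ ⟨v, hv⟩ => ⟨v, (ht.loc_le p hi).S hv⟩⟩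
  exact hno ⟨i, hi⟩

theorem eventually_sendReady (ht : t.IsExecution F Q B) (hp : p ∉ B)
    (h : HasQuorum Q p ((t.st n).loc p).ackFrom) : ∃ i, t.ev i = .sendReady p := by
  by_contra hno
  obtain ⟨i, -, hi⟩ := ht.fair (.sendReady p) trivial n fun i hi =>
    ⟨hp, by
      by_contra hs
      obtain ⟨j, -, hj⟩ := ht.exists_sendReady (by simpa using hs)
      exact hno ⟨j, hj⟩, h.mono (ht.loc_le p hi).ackFrom⟩
  exact hno ⟨i, hi⟩

theorem eventually_sendConfirm (ht : t.IsExecution F Q B) (hp : p ∉ B)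
    (h : HasQuorum Q p ((t.st n).loc p).readyFrom ∨ HasKernel Q p ((t.st n).loc p).confirmFrom) :
    ∃ i, t.ev i = .sendConfirm p := by
  by_contra hno
  obtain ⟨i, -, hi⟩ := ht.fair (.sendConfirm p) trivial n fun i hi =>
    ⟨hp, by
      by_contra hs
      obtain ⟨j, -, hj⟩ := ht.exists_sendConfirm (by simpa using hs)
      exact hno ⟨j, hj⟩, h.imp (·.mono (ht.loc_le p hi).readyFrom)
        (·.mono (ht.loc_le p hi).confirmFrom)⟩
  exact hno ⟨i, hi⟩

theorem eventually_sendT (ht : t.IsExecution F Q B) (hp : p ∉ B)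
    (h : HasQuorum Q p ((t.st n).loc p).confirmFrom) : ∃ i, t.ev i = .sendT p := by
  by_contra hno
  obtain ⟨i, -, hi⟩ := ht.fair (.sendT p) trivial n fun i hi =>
    ⟨hp, by
      by_contra hs
      obtain ⟨j, -, hj⟩ := ht.exists_sendT (by simpa using hs)
      exact hno ⟨j, hj⟩, h.mono (ht.loc_le p hi).confirmFrom⟩
  exact hno ⟨i, hi⟩

theorem eventually_agDeliver (ht : t.IsExecution F Q B) (hp : p ∉ B)
    (h : HasQuorum Q p ((t.st n).loc p).distTFrom) : ∃ i, t.ev i = .agDeliver p := by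
  by_contra hno
  obtain ⟨i, -, hi⟩ := ht.fair (.agDeliver p) trivial n fun i hi =>
    ⟨hp, by
      by_contra hs
      obtain ⟨j, -, hj⟩ := ht.exists_agDeliver (by simpa using hs)
      exact hno ⟨j, hj⟩, h.mono (ht.loc_le p hi).distTFrom⟩
  exact hno ⟨i, hi⟩

end Progress

end Trace.IsExecution

/-! ### Quorums, kernels and the maximal guild -/

section Guild

variable {P : Type*} {F Q : P → Set (Set P)} {B : Set P} {p q : P}

theorem wise_of_mem_maxGuild (hp : p ∈ maxGuild F Q B) : Wise F B p :=
  (isGuild_maxGuild F Q B).wisdom p hp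

theorem notMem_of_mem_maxGuild (hp : p ∈ maxGuild F Q B) : p ∉ B :=
  (wise_of_mem_maxGuild hp).1

/-- Quorums of wise parties intersect in a correct party. -/
theorem IsQuorumSystem.exists_correct_mem_inter (hQ : IsQuorumSystem F Q) (hp : Wise F B p)
    (hq : Wise F B q) {X Y : Set P} (hX : X ∈ Q p) (hY : Y ∈ Q q) : ∃ r ∉ B, r ∈ X ∧ r ∈ Y := by
  obtain ⟨r, hr, hB⟩ := Set.not_subset.1 (hQ.consistency p q X hX Y hY B ⟨hp.2, hq.2⟩)
  exact ⟨r, hB, hr.1, hr.2⟩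

/-- The guild contains some quorum `Z` of `p`, and any two quorums of the wise party `p` intersect.
-/
theorem IsQuorumSystem.exists_mem_maxGuild (hQ : IsQuorumSystem F Q) (hp : p ∈ maxGuild F Q B)
    {X : Set P} (hX : HasQuorum Q p X) : ∃ r ∈ maxGuild F Q B, r ∈ X := by
  obtain ⟨Y, hY, hYX⟩ := hX
  obtain ⟨Z, hZ, hZG⟩ := (isGuild_maxGuild F Q B).closure p hp
  have hw := wise_of_mem_maxGuild hp
  obtain ⟨r, -, hrY, hrZ⟩ := hQ.exists_correct_mem_inter hw hw hY hZ
  exact ⟨r, hZG hrZ, hYX hrY⟩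

theorem HasKernel.exists_mem_maxGuild (hp : p ∈ maxGuild F Q B) {X : Set P}
    (hX : HasKernel Q p X) : ∃ r ∈ maxGuild F Q B, r ∈ X := by
  obtain ⟨K, hK, hKX⟩ := hX
  obtain ⟨Z, hZ, hZG⟩ := (isGuild_maxGuild F Q B).closure p hp
  obtain ⟨r, hrK, hrZ⟩ := hK Z hZ
  exact ⟨r, hZG hrZ, hKX hrK⟩

/-- Only the quorum of `p` inside the guild is waited for; it is finite, so a single time serves all
of its members. -/
theorem eventually_hasQuorum [Finite P] {s : ℕ → Set P} (hs : Monotone s)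
    (hp : p ∈ maxGuild F Q B) (h : ∀ q ∈ maxGuild F Q B, ∃ n, q ∈ s n) :
    ∃ n, HasQuorum Q p (s n) := by
  obtain ⟨Z, hZ, hZG⟩ := (isGuild_maxGuild F Q B).closure p hp
  obtain ⟨n, hn⟩ := exists_subset_of_monotone hs Z.toFinite fun q hq => h q (hZG hq)
  exact ⟨n, Z, hZ, hn⟩

end Guild

namespace Trace.IsExecution

variable {P V : Type*} [DecidableEq P] {F Q : P → Set (Set P)} {B : Set P} {t : Trace P V}
  {p q : P} {v w : V} {A : Set (P × V)} {m n i : ℕ}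

/-! ### What the reliable broadcast gives: validity, agreement and spreading of collected values -/

section Broadcast

theorem eq_of_mem_S (ht : t.IsExecution F Q B) (hp : p ∈ maxGuild F Q B)
    (hq : q ∈ maxGuild F Q B) {r : P} (h : (r, v) ∈ ((t.st m).loc p).S)
    (h' : (r, w) ∈ ((t.st n).loc q).S) : v = w := by
  obtain ⟨k, -, hk⟩ := ht.exists_arbDeliver h
  obtain ⟨l, -, hl⟩ := ht.exists_arbDeliver h'
  exact ht.broadcast.consistency ⟨p, hp⟩ p q (wise_of_mem_maxGuild hp) (wise_of_mem_maxGuild hq)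
    r v w ⟨k, hk⟩ ⟨l, hl⟩

theorem proposes_of_mem_S (ht : t.IsExecution F Q B) (hp : p ∈ maxGuild F Q B) (hq : q ∉ B)
    (h : (q, v) ∈ ((t.st n).loc p).S) : t.Proposes q v := by
  obtain ⟨k, -, hk⟩ := ht.exists_arbDeliver h
  obtain ⟨l, -, hl⟩ := ht.broadcast.integrity ⟨p, hp⟩ p (wise_of_mem_maxGuild hp) q hq v k hk
  exact ⟨l, hl⟩

theorem eventually_mem_S (ht : t.IsExecution F Q B) (h : t.ArbDelivers p q v) :
    ∃ n, (q, v) ∈ ((t.st n).loc p).S := by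
  obtain ⟨k, hk⟩ := h
  exact ⟨k + 1, (ht.loc_le_of_event hk k.lt_succ_self p).S (by simp [step])⟩

/-- `V` may be infinite, but by consistency of the broadcast a guild member holds at most one value
per sender, so the first projection is injective on `S`. -/
theorem finite_S [Finite P] (ht : t.IsExecution F Q B) (hp : p ∈ maxGuild F Q B) (n : ℕ) :
    ((t.st n).loc p).S.Finite := by
  refine Set.Finite.of_finite_image (f := Prod.fst) (Set.toFinite _) ?_
  rintro ⟨r, v⟩ h ⟨r', w⟩ h' (rfl : r = r')
  rw [ht.eq_of_mem_S hp hp h h']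

/-- Whatever a member of the maximal guild has collected is eventually collected by every other
member. -/
theorem eventually_subset_S [Finite P] (ht : t.IsExecution F Q B) (hp : p ∈ maxGuild F Q B)
    (hq : q ∈ maxGuild F Q B) (n : ℕ) :
    ∃ k, ∀ i, k ≤ i → ((t.st n).loc p).S ⊆ ((t.st i).loc q).S := by
  obtain ⟨k, hk⟩ := exists_subset_of_monotone (s := fun i => ((t.st i).loc q).S)
    (fun _ _ h => (ht.loc_le q h).S) (ht.finite_S hp n) (by
      rintro ⟨r, v⟩ h
      obtain ⟨l, -, hl⟩ := ht.exists_arbDeliver h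
      obtain ⟨w, hw⟩ := ht.broadcast.totality p (wise_of_mem_maxGuild hp) r v ⟨l, hl⟩ q hq
      obtain ⟨j, hj⟩ := ht.eventually_mem_S hw
      -- Totality only promises some value `w` from `r`; consistency identifies it with `v`.
      exact ⟨j, ht.eq_of_mem_S hp hq h hj ▸ hj⟩)
  exact ⟨k, fun i hi => hk.trans (ht.loc_le q hi).S⟩

theorem validity (ht : t.IsExecution F Q B) : t.Validity F Q B := by
  rintro p hp _ ⟨n, -, rfl⟩ q x hx hq
  exact ht.proposes_of_mem_S hp hq.1 ((ht.T_U_subset_S n p).2 hx)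

theorem agreement (ht : t.IsExecution F Q B) : t.Agreement F Q B := by
  rintro p hp p' hp' _ _ ⟨n, -, rfl⟩ ⟨m, -, rfl⟩ q x x' hx hx'
  exact ht.eq_of_mem_S hp hp' ((ht.T_U_subset_S n p).2 hx) ((ht.T_U_subset_S m p').2 hx')

end Broadcast

/-! ### Messages between correct parties, forwards and backwards in time -/

section Links

theorem enabled_of_event (ht : t.IsExecution F Q B) {e : Event P V} (he : t.ev n = e) :
    Enabled Q B (t.st n) e :=
  he ▸ ht.enabled n

/-- A message received from a correct party has been sent by it. -/
theorem sent_of_receive (ht : t.IsExecution F Q B) (hq : q ∉ B) {c : Msg P V}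
    (h : t.ev n = .receive q p c) : (q, p, c) ∈ (t.st n).sent :=
  ((ht.enabled_of_event h).2.1.resolve_left hq).1

theorem eventually_ackFrom (ht : t.IsExecution F Q B) (hq : q ∉ B) (hp : p ∉ B)
    (h : t.ev n = .receive p q (.distributeS A)) : ∃ k, q ∈ ((t.st k).loc p).ackFrom := by
  have hs : (q, p, Msg.ack) ∈ (t.st (n + 1)).sent :=
    ht.sent_of_event h n.lt_succ_self (by simp [step, replies])
  obtain ⟨k, hk⟩ := ht.eventually_receive hq hp hs ⟨0, fun _ _ => trivial⟩
  exact ⟨k + 1, (ht.loc_le_of_event hk k.lt_succ_self p).ackFrom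
    (by simp [step, LocalState.handle])⟩

theorem eventually_readyFrom (ht : t.IsExecution F Q B) (hq : q ∉ B) (hp : p ∉ B)
    (h : t.ev n = .sendReady q) : ∃ k, q ∈ ((t.st k).loc p).readyFrom := by
  have hs : (q, p, Msg.ready) ∈ (t.st (n + 1)).sent :=
    ht.sent_of_event h n.lt_succ_self (by simp [step, toAll])
  obtain ⟨k, hk⟩ := ht.eventually_receive hq hp hs ⟨0, fun _ _ => trivial⟩
  exact ⟨k + 1, (ht.loc_le_of_event hk k.lt_succ_self p).readyFrom
    (by simp [step, LocalState.handle])⟩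

theorem eventually_confirmFrom (ht : t.IsExecution F Q B) (hq : q ∉ B) (hp : p ∉ B)
    (h : t.ev n = .sendConfirm q) : ∃ k, q ∈ ((t.st k).loc p).confirmFrom := by
  have hs : (q, p, Msg.confirm) ∈ (t.st (n + 1)).sent :=
    ht.sent_of_event h n.lt_succ_self (by simp [step, toAll])
  obtain ⟨k, hk⟩ := ht.eventually_receive hq hp hs ⟨0, fun _ _ => trivial⟩
  exact ⟨k + 1, (ht.loc_le_of_event hk k.lt_succ_self p).confirmFrom
    (by simp [step, LocalState.handle])⟩

/-- Unlike the unconditional messages above, this one needs both parties in the guild: its content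
lies in the `S` of the sender, which the receiver eventually collects too. -/
theorem eventually_distTFrom [Finite P] (ht : t.IsExecution F Q B) (hq : q ∈ maxGuild F Q B)
    (hp : p ∈ maxGuild F Q B) (h : t.ev n = .sendT q) :
    ∃ k, q ∈ ((t.st k).loc p).distTFrom := by
  have hs : (q, p, Msg.distributeT ((t.st n).loc q).T) ∈ (t.st (n + 1)).sent :=
    ht.sent_of_event h n.lt_succ_self (by simp [step, toAll])
  obtain ⟨l, hl⟩ := ht.eventually_subset_S hq hp n
  obtain ⟨k, hk⟩ := ht.eventually_receive (notMem_of_mem_maxGuild hq)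
    (notMem_of_mem_maxGuild hp) hs ⟨l, fun i hi => (ht.T_U_subset_S n q).1.trans (hl i hi)⟩
  exact ⟨k + 1, (ht.loc_le_of_event hk k.lt_succ_self p).distTFrom
    (by simp [step, LocalState.handle])⟩

theorem exists_sendReady_of_readyFrom (ht : t.IsExecution F Q B) (hq : q ∉ B)
    (h : q ∈ ((t.st n).loc p).readyFrom) : ∃ m < n, t.ev m = .sendReady q := by
  obtain ⟨m, hm, he⟩ := ht.exists_receive_ready h
  obtain ⟨k, hk, he⟩ := ht.exists_ready (ht.sent_of_receive hq he)
  exact ⟨k, hk.trans hm, he⟩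

theorem exists_sendConfirm_of_confirmFrom (ht : t.IsExecution F Q B) (hq : q ∉ B)
    (h : q ∈ ((t.st n).loc p).confirmFrom) : ∃ m < n, t.ev m = .sendConfirm q := by
  obtain ⟨m, hm, he⟩ := ht.exists_receive_confirm h
  obtain ⟨k, hk, he⟩ := ht.exists_confirm (ht.sent_of_receive hq he)
  exact ⟨k, hk.trans hm, he⟩

/-- A correct party whose `distributeT` message has been accepted has sent it before, and its
content is part of the output. -/
theorem exists_sendT_of_distTFrom (ht : t.IsExecution F Q B) (hq : q ∉ B)
    (h : q ∈ ((t.st n).loc p).distTFrom) :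
    ∃ m, t.ev m = .sendT q ∧ ((t.st m).loc q).T ⊆ ((t.st n).loc p).U := by
  obtain ⟨m, hm, A, he⟩ := ht.exists_receive_distributeT h
  obtain ⟨k, -, hk, rfl⟩ := ht.exists_distributeT (ht.sent_of_receive hq he)
  exact ⟨k, hk, fun x hx => (ht.loc_le_of_event he hm p).U
    (by simp [step, LocalState.handle, hx])⟩

/-- An acknowledgement between correct parties answers a `distributeS` message. -/
theorem exists_distributeS_of_ackFrom (ht : t.IsExecution F Q B) (hq : q ∉ B) (hp : p ∉ B)
    (h : q ∈ ((t.st n).loc p).ackFrom) :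
    ∃ k m, t.ev k = .sendS p ∧ t.ev m = .receive p q (.distributeS ((t.st k).loc p).S) := by
  obtain ⟨l, -, hl⟩ := ht.exists_receive_ack h
  obtain ⟨m, -, A, hm⟩ := ht.exists_ack (ht.sent_of_receive hq hl)
  obtain ⟨k, -, hk, rfl⟩ := ht.exists_distributeS (ht.sent_of_receive hp hm)
  exact ⟨k, m, hk, hm⟩

/-- A party stops accepting `distributeS` messages when it sends its `distributeT` message. -/
theorem subset_T_of_sendT (ht : t.IsExecution F Q B)
    (hm : t.ev m = .receive p q (.distributeS A)) (hn : t.ev n = .sendT q) :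
    A ⊆ ((t.st n).loc q).T := by
  rcases lt_trichotomy m n with h | rfl | h
  · exact fun x hx => (ht.loc_le_of_event hm h q).T (by simp [step, LocalState.handle, hx])
  · simp [hm] at hn
  · have h1 := (ht.loc_le_of_event hn h q).sentT (by simp [step])
    have h2 := (ht.enabled_of_event hm).2.2.2
    simp [h2] at h1

end Links

/-! ### Termination -/

section Termination

variable [Finite P]

theorem exists_sendS_of_proposes (ht : t.IsExecution F Q B)
    (h : ∀ p ∈ maxGuild F Q B, ∃ v, t.Proposes p v) (hp : p ∈ maxGuild F Q B) :
    ∃ i, t.ev i = .sendS p := by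
  obtain ⟨n, hn⟩ := eventually_hasQuorum (Q := Q)
    (s := fun n => {q | ∃ v, (q, v) ∈ ((t.st n).loc p).S})
    (fun _ _ h _ ⟨v, hv⟩ => ⟨v, (ht.loc_le p h).S hv⟩) hp fun q hq => by
      obtain ⟨v, hv⟩ := h q hq
      obtain ⟨n, hn⟩ := ht.eventually_mem_S
        (ht.broadcast.validity q (notMem_of_mem_maxGuild hq) v hv p hp)
      exact ⟨n, v, hn⟩
  exact ht.eventually_sendS (notMem_of_mem_maxGuild hp) hn

theorem exists_sendT_of_sendConfirm (ht : t.IsExecution F Q B)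
    (h : ∀ q ∈ maxGuild F Q B, ∃ i, t.ev i = .sendConfirm q) (hp : p ∈ maxGuild F Q B) :
    ∃ i, t.ev i = .sendT p := by
  obtain ⟨n, hn⟩ := eventually_hasQuorum (s := fun n => ((t.st n).loc p).confirmFrom)
    (fun _ _ h => (ht.loc_le p h).confirmFrom) hp fun q hq => by
      obtain ⟨i, hi⟩ := h q hq
      exact ht.eventually_confirmFrom (notMem_of_mem_maxGuild hq) (notMem_of_mem_maxGuild hp) hi
  exact ht.eventually_sendT (notMem_of_mem_maxGuild hp) hn

theorem exists_agDeliver_of_sendT (ht : t.IsExecution F Q B)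
    (h : ∀ q ∈ maxGuild F Q B, ∃ i, t.ev i = .sendT q) (hp : p ∈ maxGuild F Q B) :
    ∃ i, t.ev i = .agDeliver p := by
  obtain ⟨n, hn⟩ := eventually_hasQuorum (s := fun n => ((t.st n).loc p).distTFrom)
    (fun _ _ h => (ht.loc_le p h).distTFrom) hp fun q hq => by
      obtain ⟨i, hi⟩ := h q hq
      exact ht.eventually_distTFrom hq hp hi
  exact ht.eventually_agDeliver (notMem_of_mem_maxGuild hp) hn

/-- If every member of the maximal guild distributes a candidate set, then some member sends a
`distributeT` message: otherwise all candidate sets would be acknowledged within the guild. -/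
theorem exists_mem_sendT_of_sendS (ht : t.IsExecution F Q B) (hG : (maxGuild F Q B).Nonempty)
    (h : ∀ q ∈ maxGuild F Q B, ∃ i, t.ev i = .sendS q) :
    ∃ p ∈ maxGuild F Q B, ∃ i, t.ev i = .sendT p := by
  by_contra! hno
  have hready : ∀ p ∈ maxGuild F Q B, ∃ i, t.ev i = .sendReady p := fun p hp => by
    have hpB := notMem_of_mem_maxGuild hp
    obtain ⟨i, hi⟩ := h p hp
    obtain ⟨n, hn⟩ := eventually_hasQuorum (s := fun n => ((t.st n).loc p).ackFrom)
      (fun _ _ h => (ht.loc_le p h).ackFrom) hp fun q hq => by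
        have hqB := notMem_of_mem_maxGuild hq
        have hs : (p, q, Msg.distributeS ((t.st i).loc p).S) ∈ (t.st (i + 1)).sent :=
          ht.sent_of_event hi i.lt_succ_self (by simp [step, toAll])
        obtain ⟨l, hl⟩ := ht.eventually_subset_S hp hq i
        -- Both guards hold from time `l` on: the inclusion because `q` has collected the candidate
        -- set, and `sentT = false` because by assumption no guild member ever sends `distributeT`.
        obtain ⟨k, hk⟩ := ht.eventually_receive hpB hqB hs ⟨l, fun j hj => ⟨hl j hj, by
          by_contra hT
          obtain ⟨r, -, hr⟩ := ht.exists_sendT (by simpa using hT)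
          exact hno q hq r hr⟩⟩
        exact ht.eventually_ackFrom hqB hpB hk
    exact ht.eventually_sendReady hpB hn
  have hconfirm : ∀ p ∈ maxGuild F Q B, ∃ i, t.ev i = .sendConfirm p := fun p hp => by
    obtain ⟨n, hn⟩ := eventually_hasQuorum (s := fun n => ((t.st n).loc p).readyFrom)
      (fun _ _ h => (ht.loc_le p h).readyFrom) hp fun q hq => by
        obtain ⟨i, hi⟩ := hready q hq
        exact ht.eventually_readyFrom (notMem_of_mem_maxGuild hq) (notMem_of_mem_maxGuild hp) hi
    exact ht.eventually_sendConfirm (notMem_of_mem_maxGuild hp) (.inl hn)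
  obtain ⟨p, hp⟩ := hG
  obtain ⟨i, hi⟩ := ht.exists_sendT_of_sendConfirm hconfirm hp
  exact hno p hp i hi

/-- The correct parties that confirm to one member of the maximal guild form a kernel for every
other member, so all members send `confirm` once one of them has sent `distributeT`. -/
theorem exists_sendConfirm_of_sendT (ht : t.IsExecution F Q B) (hQ : IsQuorumSystem F Q)
    (hp : p ∈ maxGuild F Q B) (hi : t.ev i = .sendT p) (hq : q ∈ maxGuild F Q B) :
    ∃ j, t.ev j = .sendConfirm q := by
  have hqB := notMem_of_mem_maxGuild hq
  obtain ⟨X, hX, hXc⟩ := (ht.enabled_of_event hi).2.2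
  obtain ⟨n, hn⟩ := exists_subset_of_monotone (s := fun n => ((t.st n).loc q).confirmFrom)
    (fun _ _ h => (ht.loc_le q h).confirmFrom) (X := X \ B) (Set.toFinite _) fun r hr => by
      obtain ⟨j, -, hj⟩ := ht.exists_sendConfirm_of_confirmFrom hr.2 (hXc hr.1)
      exact ht.eventually_confirmFrom hr.2 hqB hj
  -- The kernel is the correct part of the quorum `X` that confirmed to `p`. Faulty members are
  -- dropped since they need not confirm to `q`; every quorum of `q` still meets `X` in a correct
  -- party.
  refine ht.eventually_sendConfirm hqB (.inr ⟨X \ B, fun Y hY => ?_, hn⟩)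
  obtain ⟨r, hrB, hrX, hrY⟩ := hQ.exists_correct_mem_inter (wise_of_mem_maxGuild hp)
    (wise_of_mem_maxGuild hq) hX hY
  exact ⟨r, ⟨hrX, hrB⟩, hrY⟩

theorem termination (ht : t.IsExecution F Q B) (hQ : IsQuorumSystem F Q)
    (h : ∀ p ∈ maxGuild F Q B, ∃ v, t.Proposes p v) (hp : p ∈ maxGuild F Q B) :
    ∃ A, t.Delivers p A := by
  obtain ⟨q, hq, i, hi⟩ := ht.exists_mem_sendT_of_sendS ⟨p, hp⟩
    fun q hq => ht.exists_sendS_of_proposes h hq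
  obtain ⟨n, hn⟩ := ht.exists_agDeliver_of_sendT (fun _ hr => ht.exists_sendT_of_sendConfirm
    (fun _ hr => ht.exists_sendConfirm_of_sendT hQ hq hi hr) hr) hp
  exact ⟨_, n, hn, rfl⟩

end Termination

/-! ### The common core -/

section Core

/-- The first member of the maximal guild that sends `confirm` has received `ready` from a quorum,
hence from another member. -/
theorem exists_mem_sendReady_of_sendConfirm (ht : t.IsExecution F Q B) (hQ : IsQuorumSystem F Q)
    (n : ℕ) : ∀ p ∈ maxGuild F Q B, t.ev n = .sendConfirm p →
      ∃ q ∈ maxGuild F Q B, ∃ i, t.ev i = .sendReady q := by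
  induction n using Nat.strong_induction_on with
  | _ n ih =>
    intro p hp hn
    rcases (ht.enabled_of_event hn).2.2 with hr | hk
    · obtain ⟨q, hq, hqr⟩ := hQ.exists_mem_maxGuild hp hr
      obtain ⟨i, -, hi⟩ := ht.exists_sendReady_of_readyFrom (notMem_of_mem_maxGuild hq) hqr
      exact ⟨q, hq, i, hi⟩
    · obtain ⟨q, hq, hqc⟩ := hk.exists_mem_maxGuild hp
      obtain ⟨i, hi, he⟩ := ht.exists_sendConfirm_of_confirmFrom (notMem_of_mem_maxGuild hq) hqc
      exact ih i hi q hq he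

/-- At each stage back from delivery, the quorum of messages relied on contains a guild member,
whose own step is then examined. -/
theorem exists_mem_sendReady_of_agDeliver (ht : t.IsExecution F Q B) (hQ : IsQuorumSystem F Q)
    (hp : p ∈ maxGuild F Q B) (hn : t.ev n = .agDeliver p) :
    ∃ q ∈ maxGuild F Q B, ∃ i, t.ev i = .sendReady q := by
  obtain ⟨q, hq, hqd⟩ := hQ.exists_mem_maxGuild hp (ht.enabled_of_event hn).2.2
  obtain ⟨i, hi, -⟩ := ht.exists_sendT_of_distTFrom (notMem_of_mem_maxGuild hq) hqd
  obtain ⟨r, hr, hrc⟩ := hQ.exists_mem_maxGuild hq (ht.enabled_of_event hi).2.2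
  obtain ⟨j, -, hj⟩ := ht.exists_sendConfirm_of_confirmFrom (notMem_of_mem_maxGuild hr) hrc
  exact ht.exists_mem_sendReady_of_sendConfirm hQ j r hr hj

/-- The candidate set of a member of the maximal guild which sends `ready` is contained in all
outputs in the maximal guild. -/
theorem exists_candidate_subset (ht : t.IsExecution F Q B) (hQ : IsQuorumSystem F Q)
    (hp : p ∈ maxGuild F Q B) (hi : t.ev i = .sendReady p) :
    ∃ k, t.ev k = .sendS p ∧
      ∀ q ∈ maxGuild F Q B, ∀ A, t.Delivers q A → ((t.st k).loc p).S ⊆ A := by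
  have hpB := notMem_of_mem_maxGuild hp
  have hack := (ht.enabled_of_event hi).2.2
  -- One acknowledgement from a correct party suffices to locate the moment `k` at which `p` fixed
  -- its candidate set, independently of the outputs considered afterwards.
  obtain ⟨r, hr, hra⟩ := hQ.exists_mem_maxGuild hp hack
  obtain ⟨k, -, hk, -⟩ := ht.exists_distributeS_of_ackFrom (notMem_of_mem_maxGuild hr) hpB hra
  refine ⟨k, hk, ?_⟩
  rintro q hq _ ⟨n, hn, rfl⟩
  obtain ⟨X, hX, hXa⟩ := hack
  obtain ⟨Y, hY, hYd⟩ := (ht.enabled_of_event hn).2.2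
  obtain ⟨s, hsB, hsX, hsY⟩ := hQ.exists_correct_mem_inter (wise_of_mem_maxGuild hp)
    (wise_of_mem_maxGuild hq) hX hY
  obtain ⟨k', m, hk', hm⟩ := ht.exists_distributeS_of_ackFrom hsB hpB (hXa hsX)
  -- Hence `s` acknowledged the very set chosen at time `k`.
  obtain rfl := ht.sendS_unique hk hk'
  obtain ⟨l, hl, hlU⟩ := ht.exists_sendT_of_distTFrom hsB (hYd hsY)
  exact (ht.subset_T_of_sendT hm hl).trans hlU

/-- A candidate set contains proposed values of the members of a quorum. -/
theorem exists_quorum_of_sendS (ht : t.IsExecution F Q B) (hQ : IsQuorumSystem F Q)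
    (hp : p ∈ maxGuild F Q B) (hk : t.ev n = .sendS p) :
    ∃ X ∈ Q p, ∃ x : P → V, (∀ q ∈ X, q ∉ B → t.Proposes q (x q)) ∧
      (fun q => (q, x q)) '' X ⊆ ((t.st n).loc p).S := by
  obtain ⟨X, hX, hXS⟩ := (ht.enabled_of_event hk).2.2
  have hw := wise_of_mem_maxGuild hp
  -- `V` is not assumed inhabited, but `X` is nonempty because it meets itself in a correct party; a
  -- value of that party serves as the default of `x` outside `X`.
  obtain ⟨r, -, hr, -⟩ := hQ.exists_correct_mem_inter hw hw hX hX
  obtain ⟨v, -⟩ := hXS hr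
  have : ∀ q, ∃ v, q ∈ X → (q, v) ∈ ((t.st n).loc p).S := fun q => by
    by_cases hq : q ∈ X
    · obtain ⟨w, hw⟩ := hXS hq
      exact ⟨w, fun _ => hw⟩
    · exact ⟨v, fun h => absurd h hq⟩
  choose x hx using this
  refine ⟨X, hX, x, fun q hq hqB => ht.proposes_of_mem_S hp hqB (hx q hq), ?_⟩
  rintro _ ⟨q, hq, rfl⟩
  exact hx q hq

theorem commonCore_and_candidateCore (ht : t.IsExecution F Q B) (hQ : IsQuorumSystem F Q)
    (hp : p ∈ maxGuild F Q B) (h : t.Delivers p A) :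
    t.CommonCore F Q B ∧ t.CandidateCore F Q B := by
  obtain ⟨n, hn, -⟩ := h
  obtain ⟨q, hq, i, hi⟩ := ht.exists_mem_sendReady_of_agDeliver hQ hp hn
  obtain ⟨k, hk, hsub⟩ := ht.exists_candidate_subset hQ hq hi
  obtain ⟨X, hX, x, hx, hxS⟩ := ht.exists_quorum_of_sendS hQ hq hk
  exact ⟨⟨q, hq, X, hX, x, hx, fun r hr A hA => hxS.trans (hsub r hr A hA)⟩,
    q, hq, _, ⟨k, hk, rfl⟩, ⟨X, hX, x, hx, hxS⟩, hsub⟩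

end Core

end Trace.IsExecution

end AsymGather

/-! ### The gather properties assembled -/

theorem mainTheorem1 {P V : Type*} [Fintype P] [DecidableEq P]
    (F Q : P → Set (Set P)) (hQ : AsymGather.IsQuorumSystem F Q) (B : Set P)
    (hG : (AsymGather.maxGuild F Q B).Nonempty)
    (t : AsymGather.Trace P V) (ht : t.IsExecution F Q B) :
    (((∀ p ∈ AsymGather.maxGuild F Q B, ∃ v, t.Proposes p v) ∨
        (∃ p ∈ AsymGather.maxGuild F Q B, ∃ A, t.Delivers p A)) →
      t.CommonCore F Q B ∧ t.CandidateCore F Q B) ∧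
    t.Validity F Q B ∧
    t.Agreement F Q B ∧
    ((∀ p ∈ AsymGather.maxGuild F Q B, ∃ v, t.Proposes p v) →
      ∀ p ∈ AsymGather.maxGuild F Q B, ∃ A, t.Delivers p A) := by
  have hterm : (∀ p ∈ AsymGather.maxGuild F Q B, ∃ v, t.Proposes p v) →
      ∀ p ∈ AsymGather.maxGuild F Q B, ∃ A, t.Delivers p A :=
    fun h p hp => ht.termination hQ h hp
  refine ⟨fun h => ?_, ht.validity, ht.agreement, hterm⟩
  -- Termination and the nonempty guild reduce the first alternative to the second.
  obtain ⟨p, hp, A, hA⟩ : ∃ p ∈ AsymGather.maxGuild F Q B, ∃ A, t.Delivers p A := by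
    rcases h with h | h
    · obtain ⟨p, hp⟩ := hG
      exact ⟨p, hp, hterm h p hp⟩
    · exact h
  exact ht.commonCore_and_candidateCore hQ hp hA
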